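/- Let $K\ge 1$, let $\mathcal S\subset\mathbb R^q$ be any subset with its Borel $\sigma$-algebra, and consider $K$-state hidden Markov models $(X_t,Y_t)_{t\ge 1}$ with observations in $\mathcal S$: $(X_t)$ is a time-homogeneous Markov chain on $\{1,\dots,K\}$ and, given $(X_t)$, the $Y_t$ are independent, the conditional distribution of $Y_t$ depending only on $X_t$ and being $F_k$ when $X_t=k$. A parameter set consists of a starting probability vector, a stochastic $K\times K$ transition matrix and $K$ probability distributions on $\mathcal S$ (the state-dependent distributions). Let $(\pi,\Gamma,F_1,\dots,F_K)$ and $(\lambda,\tilde\Gamma,\tilde F_1,\dots,\tilde F_K)$ be two parameter sets under which the joint distributions of $(Y_1,\dots,Y_{2K+1})$ are equal. Suppose that $\Gamma$ has full rank and is ergodic (irreducible and aperiodic), that $F_1,\dots,F_K$ are pairwise distinct, and that the first chain is stationary, i.e. $\pi\Gamma=\pi$. Nothing further is assumed about the second parameter set; in particular its starting distribution $\lambda$ is arbitrary. Then the two parameter sets coincide up to label swapping: there is a permutation $\sigma$ of $\{1,\dots,K\}$ such that $$\tilde\alpha_{\sigma(j),\sigma(k)}=\alpha_{j,k},\qquad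 \tilde F_{\sigma(k)}=F_k,\qquad \lambda_{\sigma(k)}=\pi_k\qquad (j,k=1,\dots,K),$$ where $\Gamma=(\alpha_{j,k})$ and $\tilde\Gamma=(\tilde\alpha_{j,k})$. -/

import Mathlib

open MeasureTheory
open scoped Matrix

/-- A parameter set of a (time-homogeneous) `K`-state hidden Markov model with observations in `S`:
a starting probability vector, a stochastic transition matrix, and the state-dependent
distributions (one probability measure on `S` per state). -/
structure HMMParam (K : ℕ) (S : Type*) [MeasurableSpace S] where
  /-- the starting distribution -/
  init : Fin K → ℝ
  /-- the transition probability matrix -/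
  trans : Matrix (Fin K) (Fin K) ℝ
  /-- the state-dependent distributions -/
  emis : Fin K → ProbabilityMeasure S
  init_mem : init ∈ stdSimplex ℝ (Fin K)
  trans_mem : trans ∈ Matrix.rowStochastic ℝ (Fin K)

/-- `(X_t, Y_t)` on the probability space `(Ω, P)` is a hidden Markov model with parameters `θ`.
Time starts at index `0`, so `X 0, Y 0` are the first state and the first observation. -/
structure IsHMM {K : ℕ} {S : Type*} [MeasurableSpace S] (θ : HMMParam K S)
    {Ω : Type*} [MeasurableSpace Ω] (P : Measure Ω) (X : ℕ → Ω → Fin K) (Y : ℕ → Ω → S) : Prop where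
  measurable_state : ∀ t, Measurable (X t)
  measurable_obs : ∀ t, Measurable (Y t)
  /-- the starting distribution of the chain -/
  map_zero : ∀ k, P.real {ω | X 0 ω = k} = θ.init k
  /-- the Markov property with homogeneous transition matrix, without division by zero -/
  markov : ∀ (n : ℕ) (x : ℕ → Fin K),
    P.real {ω | ∀ t ≤ n + 1, X t ω = x t} =
      P.real {ω | ∀ t ≤ n, X t ω = x t} * θ.trans (x n) (x (n + 1))
  /-- given the states, the observations are independent, and the conditional distribution of
  `Y t` is the state-dependent distribution of the state at time `t` -/
  emission : ∀ (n : ℕ) (x : ℕ → Fin K) (B : ℕ → Set S), (∀ t, MeasurableSet (B t)) →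
    P.real {ω | (∀ t ≤ n, X t ω = x t) ∧ ∀ t ≤ n, Y t ω ∈ B t} =
      P.real {ω | ∀ t ≤ n, X t ω = x t} *
        ∏ t ∈ Finset.range (n + 1), (θ.emis (x t) : Measure S).real (B t)

/-- A transition matrix is aperiodic if every state has period one, i.e. `1` is the only common
divisor of the possible return times. -/
def Matrix.IsAperiodic {K : ℕ} (A : Matrix (Fin K) (Fin K) ℝ) : Prop :=
  ∀ (i : Fin K) (d : ℕ), (∀ n : ℕ, 0 < n → 0 < (A ^ n) i i → d ∣ n) → d = 1

/-- A finite-state transition matrix is ergodic if it is irreducible and aperiodic. -/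
def Matrix.IsErgodic {K : ℕ} (A : Matrix (Fin K) (Fin K) ℝ) : Prop :=
  A.IsIrreducible ∧ A.IsAperiodic

/-! Word probabilities are matrix products `π D(B₁) Γ ⋯ D(Bₙ) Γ 1`, with `D(B)` the diagonal matrix
of the `F_k(B)`, and a minimal representation of this kind is unique up to a change of basis.
Minimality: a subspace containing `π` and stable under all `D(B) Γ` is stable under `Γ` (take `B =
univ`), hence under each `D(B)` as `Γ` is invertible. Distinct `F_k` make the `D(B)` generate all
diagonal matrices, and `π` is positive, so the subspace is everything (`span_forward_eq_top`);
`span_backward_eq_top` is the dual with `1`. Comparing words of length below `2K` then gives an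
invertible `T` with `T D(B) Γ = D'(B) Γ' T` (`exists_intertwiner`). Cancelling `Γ` leaves `T D(B) =
D'(B) T`, which with `T 1 = 1` makes `T` a permutation matrix. -/

/-! ### Linear algebra: spanning by words, positivity, invariant subspaces. -/

open Module in
/-- If no proper subspace contains `v` and is invariant under the operators `A i`, then `v` and its
images under words of length less than the dimension already span the whole space. -/
theorem span_words_eq_top {ι V : Type*} [AddCommGroup V] [Module ℝ V] [FiniteDimensional ℝ V]
    (A : ι → V →ₗ[ℝ] V) (v : V)
    (h : ∀ W : Submodule ℝ V, v ∈ W → (∀ i, ∀ w ∈ W, A i w ∈ W) → W = ⊤) :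
    Submodule.span ℝ {w | ∃ L : List ι, L.length < finrank ℝ V ∧
      L.foldr (fun i u => A i u) v = w} = ⊤ := by
  set W : ℕ → Submodule ℝ V := fun n => Submodule.span ℝ {w | ∃ L : List ι, L.length < n ∧
    L.foldr (fun i u => A i u) v = w}
  have hmono : ∀ n, W n ≤ W (n + 1) := fun n => Submodule.span_mono
    fun w ⟨L, hL, hw⟩ => ⟨L, by omega, hw⟩
  have hmap : ∀ n i, ∀ w ∈ W n, A i w ∈ W (n + 1) := by
    intro n i w hw
    have : W n ≤ (W (n + 1)).comap (A i) := by
      refine Submodule.span_le.2 ?_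
      rintro _ ⟨L, hL, rfl⟩
      exact Submodule.subset_span ⟨i :: L, by simpa using hL, rfl⟩
    exact this hw
  -- The dimension of `W n` grows strictly until two consecutive spaces agree; such a space is
  -- invariant and contains `v`.
  have key : ∀ n, n ≤ finrank ℝ (W n) ∨ W n = ⊤ := by
    intro n
    induction n with
    | zero => exact Or.inl (Nat.zero_le _)
    | succ n ih =>
      rcases ih with ih | ih
      · by_cases heq : W n = W (n + 1)
        · right
          refine h _ (Submodule.subset_span ⟨[], by simp, rfl⟩) fun i w hw => hmap n i w ?_
          rwa [heq]
        · left
          have := Submodule.finrank_lt_finrank_of_lt (lt_of_le_of_ne (hmono n) heq)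
          omega
      · exact Or.inr (top_le_iff.1 (ih ▸ hmono n))
  rcases key (finrank ℝ V) with h1 | h1
  · exact Submodule.eq_top_of_finrank_eq (le_antisymm (Submodule.finrank_le _) h1)
  · exact h1

/-- A spanning set of `Fin K → ℝ` contains the rows of an invertible matrix. -/
theorem exists_isUnit_of_span_eq_top {K : ℕ} {s : Set (Fin K → ℝ)}
    (hs : Submodule.span ℝ s = ⊤) :
    ∃ f : Fin K → Fin K → ℝ, (∀ i, f i ∈ s) ∧ IsUnit (Matrix.of f) := by
  have hK : Module.finrank ℝ (Submodule.span ℝ s) = K := by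
    rw [hs, finrank_top, Module.finrank_fin_fun]
  obtain ⟨f, hf, -, hli⟩ := Submodule.exists_fun_fin_finrank_span_eq ℝ s
  refine ⟨fun i => f (Fin.cast hK.symm i), fun i => hf _,
    Matrix.linearIndependent_rows_iff_isUnit.1 ?_⟩
  exact hli.comp _ (Fin.cast_injective _)

/-- A square real matrix of full rank is invertible. -/
theorem Matrix.isUnit_of_rank_eq {K : ℕ} {A : Matrix (Fin K) (Fin K) ℝ} (h : A.rank = K) :
    IsUnit A := by
  rw [← Matrix.mulVec_surjective_iff_isUnit]
  have : LinearMap.range A.mulVecLin = ⊤ :=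
    Submodule.eq_top_of_finrank_eq (by simpa [Matrix.rank] using h)
  exact LinearMap.range_eq_top.1 this

/-- A stationary distribution of an irreducible stochastic matrix is positive. -/
theorem Matrix.IsIrreducible.stationary_pos {K : ℕ} {A : Matrix (Fin K) (Fin K) ℝ}
    (hA : A.IsIrreducible) {p : Fin K → ℝ} (hp : p ∈ stdSimplex ℝ (Fin K)) (hpA : p ᵥ* A = p)
    (k : Fin K) : 0 < p k := by
  obtain ⟨j, hj⟩ : ∃ j, 0 < p j := by
    by_contra! hc
    have := hp.2
    linarith [Finset.sum_nonpos fun j (_ : j ∈ Finset.univ) => hc j]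
  obtain ⟨n, -, hn⟩ := (Matrix.isIrreducible_iff_exists_pow_pos hA.nonneg).1 hA j k
  have hpow : ∀ n : ℕ, p ᵥ* A ^ n = p := by
    intro n
    induction n with
    | zero => simp
    | succ n ih => rw [pow_succ, ← Matrix.vecMul_vecMul, ih, hpA]
  have hnn : ∀ i, 0 ≤ (A ^ n) i k := fun i => by
    have : ∀ m : ℕ, ∀ a b, 0 ≤ (A ^ m) a b := by
      intro m
      induction m with
      | zero => intro a b; by_cases h : a = b <;> simp [h]
      | succ m ih =>
        intro a b
        rw [pow_succ, Matrix.mul_apply]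
        exact Finset.sum_nonneg fun c _ => mul_nonneg (ih a c) (hA.nonneg c b)
    exact this n i k
  calc 0 < p j * (A ^ n) j k := mul_pos hj hn
    _ ≤ ∑ i, p i * (A ^ n) i k :=
      Finset.single_le_sum (f := fun i => p i * (A ^ n) i k)
        (fun i _ => mul_nonneg (hp.1 i) (hnn i)) (Finset.mem_univ j)
    _ = p k := congrFun (hpow n) k

/-- A finite-dimensional subspace mapped into itself by an invertible matrix is mapped onto
itself. -/
theorem Submodule.map_eq_self_of_injective {V : Type*} [AddCommGroup V] [Module ℝ V]
    [FiniteDimensional ℝ V] {A : V →ₗ[ℝ] V} (hA : Function.Injective A) {W : Submodule ℝ V}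
    (hW : ∀ w ∈ W, A w ∈ W) : W.map A = W :=
  Submodule.eq_of_le_of_finrank_eq (Submodule.map_le_iff_le_comap.2 hW)
    (LinearEquiv.finrank_eq (Submodule.equivMapOfInjective A hA W)).symm

/-- A subspace of `κ → ℝ` that contains a nowhere vanishing vector and is stable under
multiplication by a family of functions separating points is everything. -/
theorem Submodule.eq_top_of_mul_mem {ι κ : Type*} [Fintype κ] (g : ι → κ → ℝ)
    (hg : ∀ k l, k ≠ l → ∃ i, g i k ≠ g i l) {W : Submodule ℝ (κ → ℝ)} {v : κ → ℝ} (hv : v ∈ W)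
    (hv0 : ∀ k, v k ≠ 0) (hW : ∀ i, ∀ w ∈ W, g i * w ∈ W) : W = ⊤ := by
  classical
  -- The multipliers preserving `W` form an algebra; Lagrange interpolation puts the coordinate
  -- idempotents in it.
  let 𝒜 : Subalgebra ℝ (κ → ℝ) :=
    { carrier := {a | ∀ w ∈ W, a * w ∈ W}
      mul_mem' := fun {a b} ha hb w hw => by rw [mul_assoc]; exact ha _ (hb _ hw)
      add_mem' := fun {a b} ha hb w hw => by rw [add_mul]; exact W.add_mem (ha _ hw) (hb _ hw)
      algebraMap_mem' := fun r w hw => by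
        rw [← Algebra.smul_def]; exact W.smul_mem r hw }
  have hsingle : ∀ k, (Pi.single k 1 : κ → ℝ) ∈ 𝒜 := by
    intro k
    choose i hi using fun l : {l // l ≠ k} => hg k l l.2.symm
    have : (Pi.single k 1 : κ → ℝ) = ∏ l : {l // l ≠ k},
        (g (i l) k - g (i l) l)⁻¹ • (g (i l) - algebraMap ℝ (κ → ℝ) (g (i l) l)) := by
      ext m
      rw [Finset.prod_apply]
      by_cases hm : m = k
      · subst hm
        rw [Pi.single_eq_same]
        refine (Finset.prod_eq_one fun l _ => ?_).symm
        simpa using inv_mul_cancel₀ (sub_ne_zero.2 (hi l))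
      · rw [Pi.single_eq_of_ne hm]
        refine (Finset.prod_eq_zero (Finset.mem_univ (⟨m, hm⟩ : {l // l ≠ k})) ?_).symm
        simp
    rw [this]
    exact prod_mem fun l _ => 𝒜.smul_mem (𝒜.sub_mem (hW (i l)) (𝒜.algebraMap_mem _)) _
  refine eq_top_iff.2 fun w _ => ?_
  have : w = ∑ k, (w k / v k) • ((Pi.single k 1 : κ → ℝ) * v) := by
    ext m
    simp [Finset.sum_apply, Pi.single_apply, hv0 m]
  rw [this]
  exact W.sum_mem fun k _ => W.smul_mem _ (hsingle k v hv)

/-! ### Decomposing events along a finite-valued process. -/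

/-- Splitting an event according to the first `n` values of a finite-valued process. -/
theorem MeasureTheory.measureReal_eq_sum_paths {Ω α : Type*} [MeasurableSpace Ω] [Fintype α]
    [MeasurableSpace α] [MeasurableSingletonClass α] (P : Measure Ω) [IsFiniteMeasure P]
    {X : ℕ → Ω → α} (hX : ∀ t, Measurable (X t)) (n : ℕ) {E : Set Ω} (hE : MeasurableSet E) :
    P.real E = ∑ x : Fin n → α, P.real {ω | (∀ t : Fin n, X t ω = x t) ∧ ω ∈ E} := by
  have hm : ∀ x : Fin n → α, MeasurableSet {ω | (∀ t : Fin n, X t ω = x t) ∧ ω ∈ E} := by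
    intro x
    have : {ω | (∀ t : Fin n, X t ω = x t) ∧ ω ∈ E} = (⋂ t : Fin n, X t ⁻¹' {x t}) ∩ E := by
      ext; simp
    rw [this]
    exact (MeasurableSet.iInter fun t : Fin n => hX t (measurableSet_singleton (x t))).inter hE
  rw [← measureReal_iUnion_fintype ?_ hm]
  · congr 1
    ext ω
    simp only [Set.mem_iUnion, Set.mem_ofPred_eq]
    exact ⟨fun h => ⟨fun t => X t ω, fun _ => rfl, h⟩, fun ⟨_, _, h⟩ => h⟩
  · intro x y hxy
    refine Set.disjoint_left.2 fun ω h1 h2 => hxy (funext fun t => ?_)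
    rw [← h1.1 t, h2.1 t]

/-- Splitting an event according to the value of a finite-valued random variable. -/
theorem MeasureTheory.measureReal_eq_sum_fiber {Ω α : Type*} [MeasurableSpace Ω] [Fintype α]
    [MeasurableSpace α] [MeasurableSingletonClass α] (P : Measure Ω) [IsFiniteMeasure P]
    {X : Ω → α} (hX : Measurable X) {E : Set Ω} (hE : MeasurableSet E) :
    P.real E = ∑ k, P.real {ω | X ω = k ∧ ω ∈ E} := by
  have hm : ∀ k, MeasurableSet {ω | X ω = k ∧ ω ∈ E} := fun k =>
    (hX (measurableSet_singleton k)).inter hE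
  rw [← measureReal_iUnion_fintype ?_ hm]
  · congr 1
    ext ω
    simp
  · exact fun k l hkl => Set.disjoint_left.2 fun ω h1 h2 => hkl (h1.1.symm.trans h2.1)

/-! ### Word matrices and their spans. -/

namespace HMMParam

variable {K : ℕ} {S : Type*} [MeasurableSpace S] (θ : HMMParam K S)

/-- The probabilities of `B` under the state-dependent distributions. -/
noncomputable def emisVec (B : Set S) : Fin K → ℝ := fun k => (θ.emis k : Measure S).real B

/-- Observe a value in `B`, then move to the next state. -/
noncomputable def obsMatrix (B : Set S) : Matrix (Fin K) (Fin K) ℝ :=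
  Matrix.diagonal (θ.emisVec B) * θ.trans

/-- Observe values in the sets of a word, one after the other. -/
noncomputable def wordMatrix (L : List {B : Set S // MeasurableSet B}) :
    Matrix (Fin K) (Fin K) ℝ :=
  (L.map fun B : {B : Set S // MeasurableSet B} => θ.obsMatrix B).prod

/-- The probability of a word of measurable sets. -/
noncomputable def wordProb (L : List {B : Set S // MeasurableSet B}) : ℝ :=
  (θ.init ᵥ* θ.wordMatrix L) ⬝ᵥ 1

theorem trans_mulVec_one : θ.trans *ᵥ 1 = 1 := Matrix.one_vecMul_of_mem_rowStochastic θ.trans_mem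

@[simp] theorem emisVec_univ : θ.emisVec Set.univ = 1 := by
  ext k; simp [emisVec]

@[simp] theorem obsMatrix_univ : θ.obsMatrix Set.univ = θ.trans := by
  rw [obsMatrix, emisVec_univ]
  exact (congrArg (· * θ.trans) Matrix.diagonal_one).trans (one_mul _)

theorem wordMatrix_append (L M : List {B : Set S // MeasurableSet B}) :
    θ.wordMatrix (L ++ M) = θ.wordMatrix L * θ.wordMatrix M := by
  simp [wordMatrix]

@[simp] theorem wordMatrix_singleton (B : {B : Set S // MeasurableSet B}) :
    θ.wordMatrix [B] = θ.obsMatrix B := by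
  simp [wordMatrix]

/-- Cutting words into prefix and suffix factors the table of word probabilities through
`K`-dimensional space. -/
theorem wordProb_append (L M : List {B : Set S // MeasurableSet B}) :
    θ.wordProb (L ++ M) = (θ.init ᵥ* θ.wordMatrix L) ⬝ᵥ (θ.wordMatrix M *ᵥ 1) := by
  rw [wordProb, wordMatrix_append, ← Matrix.vecMul_vecMul, Matrix.dotProduct_mulVec]

theorem wordProb_append_append (L M N : List {B : Set S // MeasurableSet B}) :
    θ.wordProb (L ++ (M ++ N)) =
      (θ.init ᵥ* θ.wordMatrix L) ⬝ᵥ (θ.wordMatrix M *ᵥ (θ.wordMatrix N *ᵥ 1)) := by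
  rw [wordProb_append, wordMatrix_append, Matrix.mulVec_mulVec]

variable {θ}

theorem exists_emisVec_ne (h : Function.Injective θ.emis) {k l : Fin K} (hkl : k ≠ l) :
    ∃ B : {B : Set S // MeasurableSet B}, θ.emisVec B k ≠ θ.emisVec B l := by
  by_contra! hc
  exact hkl (h (Subtype.ext (Measure.ext fun B hB =>
    (measureReal_eq_measureReal_iff (measure_ne_top (θ.emis k : Measure S) B)
      (measure_ne_top (θ.emis l : Measure S) B)).1 (hc ⟨B, hB⟩))))

/-- The state vectors reached after observing fewer than `K` values span everything. -/
theorem span_forward_eq_top (hunit : IsUnit θ.trans) (hpos : ∀ k, 0 < θ.init k)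
    (h : Function.Injective θ.emis) :
    Submodule.span ℝ {w | ∃ L : List {B : Set S // MeasurableSet B}, L.length < K ∧
      θ.init ᵥ* θ.wordMatrix L = w} = ⊤ := by
  have key := span_words_eq_top (V := Fin K → ℝ)
    (fun B : {B : Set S // MeasurableSet B} => (θ.obsMatrix B).vecMulLinear) θ.init ?_
  · rw [Module.finrank_fin_fun] at key
    rw [eq_top_iff, ← key]
    refine Submodule.span_mono ?_
    rintro _ ⟨L, hL, rfl⟩
    -- Row vectors absorb the first letter first, whereas `foldr` applies it last.
    refine ⟨L.reverse, by simpa using hL, ?_⟩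
    clear hL
    induction L with
    | nil => simp [wordMatrix]
    | cons B L ih =>
      rw [List.reverse_cons, wordMatrix_append, ← Matrix.vecMul_vecMul, ih, wordMatrix_singleton]
      rfl
  · intro W hv hW
    have hinj : Function.Injective θ.trans.vecMulLinear := Matrix.vecMul_injective_iff_isUnit.2 hunit
    have hmap := Submodule.map_eq_self_of_injective hinj (W := W) fun w hw => by
      simpa using hW ⟨Set.univ, MeasurableSet.univ⟩ w hw
    refine Submodule.eq_top_of_mul_mem (fun B : {B : Set S // MeasurableSet B} => θ.emisVec B)
      -- Since `W Γ = W`, the vector `w D(B) Γ` equals `u Γ` with `u ∈ W`; injectivity of `Γ` gives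
      -- `w D(B) = u`.
      (fun k l hkl => exists_emisVec_ne h hkl) hv (fun k => (hpos k).ne') fun B w hw => ?_
    have hw' := hW B w hw
    rw [← hmap] at hw'
    obtain ⟨u, hu, hu'⟩ := hw'
    have : θ.emisVec B * w = u := by
      refine hinj (Eq.trans ?_ hu'.symm)
      simp only [Matrix.vecMulLinear_apply, obsMatrix, ← Matrix.vecMul_vecMul]
      congr 1
      ext k
      simp [Matrix.vecMul_diagonal, mul_comm]
    exact this ▸ hu

/-- The vectors of conditional probabilities of words shorter than `K` span everything. -/
theorem span_backward_eq_top (hunit : IsUnit θ.trans) (h : Function.Injective θ.emis) :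
    Submodule.span ℝ {w | ∃ L : List {B : Set S // MeasurableSet B}, L.length < K ∧
      θ.wordMatrix L *ᵥ 1 = w} = ⊤ := by
  have key := span_words_eq_top (V := Fin K → ℝ)
    (fun B : {B : Set S // MeasurableSet B} => (θ.obsMatrix B).mulVecLin) 1 ?_
  · rw [Module.finrank_fin_fun] at key
    rw [eq_top_iff, ← key]
    refine Submodule.span_mono ?_
    rintro _ ⟨L, hL, rfl⟩
    refine ⟨L, hL, ?_⟩
    clear hL
    induction L with
    | nil => simp [wordMatrix]
    | cons B L ih =>
      rw [List.foldr_cons, ← ih]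
      simp [wordMatrix]
  · intro W hv hW
    have hinj : Function.Injective θ.trans.mulVecLin := Matrix.mulVec_injective_iff_isUnit.2 hunit
    have hmap := Submodule.map_eq_self_of_injective hinj (W := W) fun w hw => by
      simpa using hW ⟨Set.univ, MeasurableSet.univ⟩ w hw
    refine Submodule.eq_top_of_mul_mem (fun B : {B : Set S // MeasurableSet B} => θ.emisVec B)
      (fun k l hkl => exists_emisVec_ne h hkl) hv (fun k => one_ne_zero) fun B w hw => ?_
    -- Here `Γ` acts before `D(B)`, so writing `w = Γ u` with `u ∈ W` suffices.
    rw [← hmap] at hw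
    obtain ⟨u, hu, rfl⟩ := hw
    convert hW B u hu using 1
    ext k
    simp [obsMatrix, Matrix.mulVec_diagonal]

end HMMParam

/-! ### From the process to word probabilities. -/

namespace IsHMM

variable {K : ℕ} {S : Type*} [MeasurableSpace S] {θ : HMMParam K S} {Ω : Type*}
  [MeasurableSpace Ω] {P : Measure Ω} {X : ℕ → Ω → Fin K} {Y : ℕ → Ω → S}

theorem measurableSet_obs (h : IsHMM θ P X Y) {B : ℕ → Set S} (hB : ∀ t, MeasurableSet (B t))
    (n : ℕ) : MeasurableSet {ω | ∀ t ≤ n, Y t ω ∈ B t} := by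
  have : {ω | ∀ t ≤ n, Y t ω ∈ B t} = ⋂ t, ⋂ (_ : t ≤ n), Y t ⁻¹' B t := by
    ext; simp
  rw [this]
  exact MeasurableSet.iInter fun t => MeasurableSet.iInter fun _ => h.measurable_obs t (hB t)

/-- One step of the forward recursion along a fixed path. -/
theorem path_succ (h : IsHMM θ P X Y) {B : ℕ → Set S} (hB : ∀ t, MeasurableSet (B t)) (n : ℕ)
    (x : ℕ → Fin K) :
    P.real {ω | (∀ t ≤ n + 1, X t ω = x t) ∧ ∀ t ≤ n + 1, Y t ω ∈ B t} =
      P.real {ω | (∀ t ≤ n, X t ω = x t) ∧ ∀ t ≤ n, Y t ω ∈ B t} *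
        (θ.trans (x n) (x (n + 1)) * θ.emisVec (B (n + 1)) (x (n + 1))) := by
  rw [h.emission _ _ _ hB, h.emission _ _ _ hB, h.markov, Finset.prod_range_succ _ (n + 1),
    HMMParam.emisVec]
  ring

theorem forward_zero (h : IsHMM θ P X Y) {B : ℕ → Set S} (hB : ∀ t, MeasurableSet (B t))
    (k : Fin K) :
    P.real {ω | X 0 ω = k ∧ ∀ t ≤ 0, Y t ω ∈ B t} = θ.init k * θ.emisVec (B 0) k := by
  have := h.emission 0 (fun _ => k) B hB
  simp only [Nat.le_zero, forall_eq, zero_add, Finset.range_one, Finset.prod_singleton,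
    h.map_zero] at this
  simpa [HMMParam.emisVec] using this

/-- The forward recursion. -/
theorem forward_succ [IsProbabilityMeasure P] (h : IsHMM θ P X Y) {B : ℕ → Set S} (hB : ∀ t, MeasurableSet (B t))
    (n : ℕ) (k : Fin K) :
    P.real {ω | X (n + 1) ω = k ∧ ∀ t ≤ n + 1, Y t ω ∈ B t} =
      (∑ j, P.real {ω | X n ω = j ∧ ∀ t ≤ n, Y t ω ∈ B t} * θ.trans j k) *
        θ.emisVec (B (n + 1)) k := by
  have hX := h.measurable_state
  have hsing : ∀ t j, MeasurableSet {ω | X t ω = j} := fun t j =>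
    hX t (measurableSet_singleton j)
  have hE : ∀ k, MeasurableSet {ω | X (n + 1) ω = k ∧ ∀ t ≤ n + 1, Y t ω ∈ B t} := fun k =>
    (hsing (n + 1) k).inter (h.measurableSet_obs hB (n + 1))
  have hstep : ∀ j, P.real {ω | X n ω = j ∧ X (n + 1) ω = k ∧ ∀ t ≤ n + 1, Y t ω ∈ B t} =
      P.real {ω | X n ω = j ∧ ∀ t ≤ n, Y t ω ∈ B t} *
        (θ.trans j k * θ.emisVec (B (n + 1)) k) := by
    intro j
    have hE' : MeasurableSet {ω | X n ω = j ∧ X (n + 1) ω = k ∧ ∀ t ≤ n + 1, Y t ω ∈ B t} :=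
      (hsing n j).inter (hE k)
    have hE'' : MeasurableSet {ω | X n ω = j ∧ ∀ t ≤ n, Y t ω ∈ B t} :=
      (hsing n j).inter (h.measurableSet_obs hB n)
    rw [measureReal_eq_sum_paths P hX n hE', measureReal_eq_sum_paths P hX n hE'', Finset.sum_mul]
    refine Finset.sum_congr rfl fun x _ => ?_
    -- The path `x`, then `j` at time `n` and `k` at time `n + 1`; later values play no role.
    let y : ℕ → Fin K := fun t => if ht : t < n then x ⟨t, ht⟩ else if t = n then j else k
    have hyn : y n = j := by simp [y]
    have hyn' : y (n + 1) = k := by simp [y]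
    have hy : ∀ ω, (∀ t ≤ n, X t ω = y t) ↔ (∀ t : Fin n, X t ω = x t) ∧ X n ω = j := by
      intro ω
      constructor
      · intro hω
        exact ⟨fun t => by simpa [y] using hω t t.2.le, by simpa [y] using hω n le_rfl⟩
      · rintro ⟨h1, h2⟩ t ht
        rcases ht.lt_or_eq with ht | rfl
        · simpa [y, ht] using h1 ⟨t, ht⟩
        · simpa [y] using h2
    have hy' : ∀ ω, (∀ t ≤ n + 1, X t ω = y t) ↔
        ((∀ t : Fin n, X t ω = x t) ∧ X n ω = j) ∧ X (n + 1) ω = k := by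
      intro ω
      rw [← hy, ← hyn']
      constructor
      · exact fun hω => ⟨fun t ht => hω t (by omega), hω _ le_rfl⟩
      · rintro ⟨h1, h2⟩ t ht
        rcases Nat.le_or_eq_of_le_succ ht with ht | rfl
        · exact h1 t ht
        · exact h2
    have := h.path_succ hB n y
    rw [hyn, hyn'] at this
    simp only [hy, hy'] at this
    convert this using 3
    · ext ω; simp only [Set.mem_ofPred_eq, and_assoc]
    · ext ω; simp only [Set.mem_ofPred_eq, and_assoc]
  rw [measureReal_eq_sum_fiber P (hX n) (hE k), Finset.sum_mul]
  exact Finset.sum_congr rfl fun j _ => (hstep j).trans (mul_assoc _ _ _).symm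

/-- The law of the observations, evaluated on rectangles by the forward recursion. -/
theorem vecMul_wordMatrix_range_succ [IsProbabilityMeasure P] (h : IsHMM θ P X Y)
    (B : ℕ → {B : Set S // MeasurableSet B}) (n : ℕ) :
    θ.init ᵥ* θ.wordMatrix ((List.range (n + 1)).map B) =
      (fun k => P.real {ω | X n ω = k ∧ ∀ t ≤ n, Y t ω ∈ (B t : Set S)}) ᵥ* θ.trans := by
  induction n with
  | zero =>
    simp only [h.forward_zero fun t => (B t).2]
    simp only [zero_add, List.range_one, List.map_cons, List.map_nil,
      HMMParam.wordMatrix_singleton, HMMParam.obsMatrix, ← Matrix.vecMul_vecMul]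
    congr 1
    ext k
    rw [Matrix.vecMul_diagonal]
  | succ n ih =>
    rw [List.range_succ, List.map_append, HMMParam.wordMatrix_append, ← Matrix.vecMul_vecMul, ih]
    simp only [h.forward_succ fun t => (B t).2]
    simp only [List.map_cons, List.map_nil, HMMParam.wordMatrix_singleton, HMMParam.obsMatrix,
      ← Matrix.vecMul_vecMul]
    congr 1
    ext k
    rw [Matrix.vecMul_diagonal]
    rfl

/-- The probability of a word of measurable sets is the probability that the first observations
lie in these sets. -/
theorem wordProb_eq [IsProbabilityMeasure P] (h : IsHMM θ P X Y) (L : List {B : Set S // MeasurableSet B}) :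
    θ.wordProb L = P.real {ω | ∀ t (ht : t < L.length), Y t ω ∈ (L[t] : Set S)} := by
  rcases Nat.eq_zero_or_pos L.length with h0 | h0
  · obtain rfl := List.length_eq_zero_iff.1 h0
    simpa [HMMParam.wordProb, HMMParam.wordMatrix, dotProduct] using θ.init_mem.2
  obtain ⟨n, hn⟩ : ∃ n, L.length = n + 1 := ⟨L.length - 1, by omega⟩
  set B : ℕ → {B : Set S // MeasurableSet B} :=
    fun t => L.getD t ⟨Set.univ, MeasurableSet.univ⟩
  have hL : L = (List.range (n + 1)).map B := by
    refine List.ext_getElem (by simp [hn]) fun t h1 h2 => ?_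
    simp [B, h1]
  have hset : {ω | ∀ t (ht : t < L.length), Y t ω ∈ (L[t] : Set S)} =
      {ω | ∀ t ≤ n, Y t ω ∈ (B t : Set S)} := by
    ext ω
    refine forall_congr' fun t => ?_
    constructor
    · intro hω ht
      have ht' : t < L.length := by omega
      simpa [B, ht'] using hω ht'
    · intro hω ht'
      simpa [B, ht'] using hω (by omega)
  rw [hset, measureReal_eq_sum_fiber P (h.measurable_state n)
    (h.measurableSet_obs (fun t => (B t).2) n), HMMParam.wordProb]
  conv_lhs => rw [hL]
  -- The transition after the last observation is absorbed by `1`.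
  rw [h.vecMul_wordMatrix_range_succ, ← Matrix.dotProduct_mulVec, θ.trans_mulVec_one]
  simp [dotProduct]

/-- Two hidden Markov models whose first `n` observations have the same law assign the same
probability to words of length at most `n`. -/
theorem wordProb_congr [IsProbabilityMeasure P] (h : IsHMM θ P X Y) {θ' : HMMParam K S} {Ω' : Type*} [MeasurableSpace Ω']
    {P' : Measure Ω'} [IsProbabilityMeasure P'] {X' : ℕ → Ω' → Fin K} {Y' : ℕ → Ω' → S}
    (h' : IsHMM θ' P' X' Y') {n : ℕ}
    (hlaw : P.map (fun ω (t : Fin n) => Y t ω) = P'.map (fun ω (t : Fin n) => Y' t ω))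
    {L : List {B : Set S // MeasurableSet B}} (hL : L.length ≤ n) :
    θ.wordProb L = θ'.wordProb L := by
  rw [h.wordProb_eq, h'.wordProb_eq]
  let E : Set (Fin n → S) := {y | ∀ t (ht : t < L.length), y ⟨t, ht.trans_le hL⟩ ∈ (L[t] : Set S)}
  have hE : MeasurableSet E := by
    have : E = ⋂ t, ⋂ (ht : t < L.length),
        (fun y : Fin n → S => y ⟨t, ht.trans_le hL⟩) ⁻¹' (L[t] : Set S) := by
      ext; simp [E]
    rw [this]
    exact MeasurableSet.iInter fun t => MeasurableSet.iInter fun ht =>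
      measurable_pi_apply _ (L[t]).2
  have h1 := map_measureReal_apply (μ := P)
    (measurable_pi_lambda _ fun t : Fin n => h.measurable_obs t) hE
  have h2 := map_measureReal_apply (μ := P')
    (measurable_pi_lambda _ fun t : Fin n => h'.measurable_obs t) hE
  rw [hlaw] at h1
  exact h1.symm.trans h2

end IsHMM

/-! ### The intertwining matrix is a permutation. -/

namespace HMMParam

variable {K : ℕ} {S : Type*} [MeasurableSpace S] {θ θ' : HMMParam K S}

/-- Parameter sets giving the same probability to words of length less than `2 * K` are linked by
an invertible matrix. -/
theorem exists_intertwiner (hunit : IsUnit θ.trans) (hpos : ∀ k, 0 < θ.init k)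
    (hinj : Function.Injective θ.emis)
    (hword : ∀ L : List {B : Set S // MeasurableSet B}, L.length < 2 * K →
      θ.wordProb L = θ'.wordProb L) :
    ∃ T : Matrix (Fin K) (Fin K) ℝ, IsUnit T ∧ T *ᵥ 1 = 1 ∧ θ'.init ᵥ* T = θ.init ∧
      ∀ B : Set S, MeasurableSet B → T * θ.obsMatrix B = θ'.obsMatrix B * T := by
  obtain ⟨f, hf, hU⟩ := exists_isUnit_of_span_eq_top (span_forward_eq_top hunit hpos hinj)
  obtain ⟨g, hg, hR⟩ := exists_isUnit_of_span_eq_top (span_backward_eq_top hunit hinj)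
  choose a ha hfa using hf
  choose b hb hgb using hg
  obtain rfl : (fun i => θ.init ᵥ* θ.wordMatrix (a i)) = f := funext hfa
  obtain rfl : (fun i => θ.wordMatrix (b i) *ᵥ 1) = g := funext hgb
  set U := Matrix.of fun i => θ.init ᵥ* θ.wordMatrix (a i)
  set R := (Matrix.of fun i => θ.wordMatrix (b i) *ᵥ 1)ᵀ
  set U' := Matrix.of fun i => θ'.init ᵥ* θ'.wordMatrix (a i)
  set R' := (Matrix.of fun i => θ'.wordMatrix (b i) *ᵥ 1)ᵀ
  replace hR : IsUnit R := (Matrix.isUnit_transpose _).2 hR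
  have h1 : U * R = U' * R' := by
    ext i j
    have := hword (a i ++ b j) (by have := ha i; have := hb j; simp; omega)
    rwa [wordProb_append, wordProb_append] at this
  have h2 : ∀ B : Set S, MeasurableSet B → U * θ.obsMatrix B * R = U' * θ'.obsMatrix B * R' := by
    intro B hB
    ext i j
    -- The longest words needed: `(K - 1) + 1 + (K - 1) < 2 * K`.
    have := hword (a i ++ ([⟨B, hB⟩] ++ b j)) (by have := ha i; have := hb j; simp; omega)
    rw [wordProb_append_append, wordProb_append_append] at this
    rw [Matrix.mul_assoc, Matrix.mul_assoc]
    rw [wordMatrix_singleton, wordMatrix_singleton] at this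
    exact this
  have h3 : U *ᵥ 1 = U' *ᵥ 1 := by
    ext i
    exact hword (a i) (by have := ha i; omega)
  have h4 : θ.init ᵥ* R = θ'.init ᵥ* R' := by
    ext j
    have := hword ([] ++ b j) (by have := hb j; simp; omega)
    rw [wordProb_append, wordProb_append] at this
    simp only [wordMatrix, List.map_nil, List.prod_nil, Matrix.vecMul_one] at this
    exact this
  -- Invertibility passes to the second model through `U * R = U' * R'`.
  have hU' : IsUnit U' := by
    have hUR := hU.mul hR
    rw [h1, Matrix.isUnit_iff_isUnit_det, Matrix.det_mul] at hUR
    exact (Matrix.isUnit_iff_isUnit_det _).2 (isUnit_of_mul_isUnit_left hUR)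
  obtain ⟨V, hV, hV'⟩ := isUnit_iff_exists.1 hU'
  have hR1 : V * U * R = R' := by rw [mul_assoc, h1, ← mul_assoc, hV', one_mul]
  -- `T = U'⁻¹ U`, which also satisfies `T R = R'`.
  refine ⟨V * U, ?_, ?_, ?_, ?_⟩
  · exact (isUnit_iff_exists.2 ⟨U', hV', hV⟩).mul hU
  · rw [← Matrix.mulVec_mulVec, h3, Matrix.mulVec_mulVec, hV', Matrix.one_mulVec]
  · refine Matrix.vecMul_injective_iff_isUnit.2 hR ?_
    simp only [Matrix.vecMul_vecMul, hR1, h4]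
  · intro B hB
    refine hR.mul_right_cancel ?_
    rw [mul_assoc (θ'.obsMatrix B), hR1, mul_assoc V, mul_assoc V, h2 B hB, mul_assoc U',
      ← mul_assoc V, hV', one_mul]

/-- Identifiability of stationary hidden Markov models from the probabilities of words of length
less than `2 * K`. -/
theorem eq_up_to_relabelling (hunit : IsUnit θ.trans) (hpos : ∀ k, 0 < θ.init k)
    (hinj : Function.Injective θ.emis)
    (hword : ∀ L : List {B : Set S // MeasurableSet B}, L.length < 2 * K →
      θ.wordProb L = θ'.wordProb L) :
    ∃ σ : Equiv.Perm (Fin K),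
      (∀ j k, θ'.trans (σ j) (σ k) = θ.trans j k) ∧
      (∀ k, θ'.emis (σ k) = θ.emis k) ∧
      (∀ k, θ'.init (σ k) = θ.init k) := by
  obtain ⟨T, hT, hT1, hTinit, hTobs⟩ := exists_intertwiner hunit hpos hinj hword
  have htrans : T * θ.trans = θ'.trans * T := by simpa using hTobs _ MeasurableSet.univ
  have hdiag : ∀ B : Set S, MeasurableSet B →
      T * Matrix.diagonal (θ.emisVec B) = Matrix.diagonal (θ'.emisVec B) * T := by
    intro B hB
    refine hunit.mul_right_cancel ?_
    rw [mul_assoc, mul_assoc, htrans, ← mul_assoc (Matrix.diagonal _)]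
    exact hTobs B hB
  -- Entrywise, `hdiag` says `T i j * (F_j(B) - F'_i(B)) = 0`.
  have hemis : ∀ i j, T i j ≠ 0 → θ'.emis i = θ.emis j := by
    intro i j hij
    refine Subtype.ext (Measure.ext fun B hB =>
      (measureReal_eq_measureReal_iff (measure_ne_top (θ'.emis i : Measure S) B)
        (measure_ne_top (θ.emis j : Measure S) B)).1 ?_)
    have := congrFun (congrFun (hdiag B hB) i) j
    rw [Matrix.mul_diagonal, Matrix.diagonal_mul, mul_comm] at this
    exact (mul_right_cancel₀ hij this).symm
  have hrow : ∀ i, ∃ j, T i j ≠ 0 := by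
    intro i
    by_contra! hc
    have := congrFun hT1 i
    simp [Matrix.mulVec, dotProduct, hc] at this
  choose τ hτ using hrow
  have hzero : ∀ i j, j ≠ τ i → T i j = 0 := by
    intro i j hj
    by_contra hc
    exact hj (hinj ((hemis i j hc).symm.trans (hemis i _ (hτ i))))
  have hone : ∀ i, T i (τ i) = 1 := by
    intro i
    have := congrFun hT1 i
    rw [Matrix.mulVec, dotProduct, Finset.sum_eq_single (τ i)] at this
    · simpa using this
    · intro j _ hj; simp [hzero i j hj]
    · simp
  have hTij : ∀ i j, T i j = if j = τ i then 1 else 0 := by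
    intro i j
    split_ifs with h
    · rw [h, hone]
    · exact hzero i j h
  have hτinj : Function.Injective τ := by
    intro i i' h
    have hrows : T.row i = T.row i' := funext fun j => by simp [Matrix.row, hTij, h]
    exact (Matrix.linearIndependent_rows_iff_isUnit.2 hT).injective hrows
  let e : Equiv.Perm (Fin K) := Equiv.ofBijective τ (Finite.injective_iff_bijective.1 hτinj)
  have he : ∀ k, τ (e.symm k) = k := fun k => e.apply_symm_apply k
  -- `τ` sends states of the second model to those of the first, so the relabelling is its inverse.
  refine ⟨e.symm, fun j k => ?_, fun k => ?_, fun k => ?_⟩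
  · have := congrFun (congrFun htrans (e.symm j)) k
    simp only [Matrix.mul_apply, hTij, he] at this
    rw [Finset.sum_eq_single j (by intro l _ hl; simp [hl]) (by simp),
      Finset.sum_eq_single (e.symm k) (fun l _ hl => ?_) (by simp)] at this
    · simpa [he] using this.symm
    · rw [if_neg, mul_zero]
      rintro rfl
      exact hl (e.symm_apply_apply l).symm
  · simpa [he] using hemis (e.symm k) (τ (e.symm k)) (hτ _)
  · have := congrFun hTinit k
    rw [Matrix.vecMul, dotProduct, Finset.sum_eq_single (e.symm k)] at this
    · simpa [hTij, he] using this
    · intro l _ hl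
      rw [hTij, if_neg, mul_zero]
      rintro rfl
      exact hl (e.symm_apply_apply l).symm
    · simp

end HMMParam

theorem mainTheorem1 {K q : ℕ} {S : Set (EuclideanSpace ℝ (Fin q))}
    (θ θ' : HMMParam K S)
    {Ω Ω' : Type*} [MeasurableSpace Ω] [MeasurableSpace Ω']
    (P : Measure Ω) [IsProbabilityMeasure P] (P' : Measure Ω') [IsProbabilityMeasure P']
    (X : ℕ → Ω → Fin K) (Y : ℕ → Ω → S) (X' : ℕ → Ω' → Fin K) (Y' : ℕ → Ω' → S)
    (hXY : IsHMM θ P X Y) (hXY' : IsHMM θ' P' X' Y')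
    (hrank : θ.trans.rank = K) (hergodic : θ.trans.IsErgodic)
    (hdistinct : Function.Injective θ.emis)
    (hstat : θ.init ᵥ* θ.trans = θ.init)
    (hlaw : P.map (fun ω (t : Fin (2 * K + 1)) => Y t ω) =
      P'.map (fun ω (t : Fin (2 * K + 1)) => Y' t ω)) :
    ∃ σ : Equiv.Perm (Fin K),
      (∀ j k, θ'.trans (σ j) (σ k) = θ.trans j k) ∧
      (∀ k, θ'.emis (σ k) = θ.emis k) ∧
      (∀ k, θ'.init (σ k) = θ.init k) :=
  HMMParam.eq_up_to_relabelling (Matrix.isUnit_of_rank_eq hrank)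
    (hergodic.1.stationary_pos θ.init_mem hstat) hdistinct
    fun _ hL => hXY.wordProb_congr hXY' hlaw (by omega)
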